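/- Let $X$ be a simplicial complete toric surface over $\mathbb C$ with primitive ray generators $v_1,\dots,v_m\in\mathbb Z^2$, homogeneous coordinate ring $S_X=\mathbb C[z_1,\dots,z_m]$ graded by $Cl(X)$ ($\deg z_i=[\mathcal D_i]$, the class of the torus-invariant divisor of $v_i$), and irrelevant locus $Z\subset\mathbb C^m$. Let $\mathcal D\in Cl(X)$ and let $\alpha=\sum_{j=1}^m A_j\,dz_j\in\mathcal F_1(X,\mathcal D)$ be a codimension one foliation: $A_j$ is homogeneous of degree $\mathcal D-[\mathcal D_j]$, $\sum_i a_iz_iA_i=0$ for every integer relation $\sum_i a_iv_i=0$, $\alpha\wedge d\alpha=0$, and the singular set of $\alpha$ has codimension $\ge 2$. Let $e_1v_1+\dots+e_mv_m=0$ with $e_k\in\mathbb N$, and let $F=(F_1,\dots,F_m)$ with $F_k\in\mathbb C[x_0,\dots,x_n]=S_{\mathbb P^n}$ homogeneous of degree $e_k$ be a polynomial lifting of a rational map $\mathbb P^n\dashrightarrow X$. Put $\omega=F^*\alpha=\sum_j A_j(F)\,dF_j$ and assume $\omega\in\mathcal F_1(\mathbb P^n,\ell)$, that is, $\omega$ is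 a twisted integrable $1$-form of degree $\ell$ on $\mathbb P^n$ whose singular set has codimension $\ge2$. Let $J(\alpha)=\langle A_1,\dots,A_m\rangle$, let $\mathscr C(d\alpha)\subset S_X$ be the ideal generated by the coefficients of $d\alpha$, let $Sing(\omega)\subset\mathbb P^n$ be the scheme defined by the coefficients of $\omega$, and assume that $(F,\alpha)$ is generic: I) no critical value of $F$ lies in the singular set of $\alpha$, and the scheme $Sing(\omega)$ is reduced at the critical points of $F$ (the points $x\in\mathbb P^n$ with $F(x)\notin Z$ at which the differential of $F:\mathbb P^n\dashrightarrow X$ is not surjective; at a quotient singularity of $X$ the tangent space of $X$ is understood as $T_{F(x)}\mathbb C^m$ modulo the tangent space of the orbit of the group $\mathrm{Hom}(Cl(X),\mathbb C^*)$); II) the ideal $J(\alpha)$ is radical and has codimension $\ge2$; III) the ideal $\mathscr C(d\alpha)$ has codimension $\ge3$. Assume also that the ring homomorphism $F^*:S_X\to S_{\mathbb P^n}$, $z_k\mapsto F_k$, is flat. A first order deformation of $\omega$ is an $\eta\in H^0(\mathbb P^n,\Omega^1_{\mathbb P^n}(\ell))$ with $\omega\wedge d\eta+\eta\wedge d\omega=0$;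 let $D(\omega)$ be the space of these modulo $\langle\omega\rangle$. A first order unfolding of $\omega$ is a pair $(h,\eta)$ with $h\in H^0(\mathbb P^n,\mathcal O(\ell))$, $\eta\in H^0(\mathbb P^n,\Omega^1_{\mathbb P^n}(\ell))$ and $h\,d\omega=\omega\wedge(\eta-dh)$; let $D_U(\omega)\subset D(\omega)$ be the set of the classes of the $\eta$ occurring in such pairs. Let $\eta$ be a first order deformation of $\omega$. Then its class lies in $D_U(\omega)$ if and only if $$\eta=\sum_{j=1}^m\sum_{k=1}^m\frac{\partial A_j}{\partial z_k}(F)\,G_k\,dF_j+\sum_{k=1}^m A_k(F)\,dG_k$$ for some homogeneous polynomials $G_k\in\mathbb C[x_0,\dots,x_n]$ of degree $e_k$, $k=1,\dots,m$ (possibly zero). Moreover, for every such $G=(G_1,\dots,G_m)$ one has $\omega+\varepsilon\eta=(F+\varepsilon G)^*\alpha$ over $\mathbb C[\varepsilon]/(\varepsilon^2)$. -/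

import Mathlib

namespace ToricFoliation

open MvPolynomial

noncomputable section

/-! ### Differential forms on affine space, in coordinates

The Kähler differentials of the polynomial ring `R[z_i : i ∈ σ]` are free on the `dz_i`.
A 1-form `∑ A_i dz_i` is the family of its coefficients, a 2-form is the alternating family of its
coefficients on `dz_i ∧ dz_j`, a 3-form that of its coefficients on `dz_i ∧ dz_j ∧ dz_k`. -/

section Forms

variable {σ τ R : Type*} [CommRing R]

/-- The 1-form `∑ i, α i • dz_i`. -/
abbrev Form1 (σ R : Type*) [CommRing R] := σ → MvPolynomial σ R

/-- The 2-form with coefficient `β i j` on `dz_i ∧ dz_j`. -/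
abbrev Form2 (σ R : Type*) [CommRing R] := σ → σ → MvPolynomial σ R

/-- The 3-form with coefficient `γ i j k` on `dz_i ∧ dz_j ∧ dz_k`. -/
abbrev Form3 (σ R : Type*) [CommRing R] := σ → σ → σ → MvPolynomial σ R

/-- The differential `df = ∑ i, ∂f/∂z_i dz_i` (relative to the coefficient ring `R`). -/
def differential (f : MvPolynomial σ R) : Form1 σ R := fun i => pderiv i f

/-- The exterior derivative `dα` of a 1-form. -/
def extD (α : Form1 σ R) : Form2 σ R :=
  fun i j => pderiv i (α j) - pderiv j (α i)

/-- The product `α ∧ β` of two 1-forms. -/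
def wedge (α β : Form1 σ R) : Form2 σ R := fun i j => α i * β j - α j * β i

/-- The product `α ∧ β` of a 1-form and a 2-form. -/
def wedgeTwo (α : Form1 σ R) (β : Form2 σ R) : Form3 σ R :=
  fun i j k => α i * β j k + α j * β k i + α k * β i j

/-- The pullback `∑ j, α_j(F) dF_j` of `α` by the polynomial map with coordinates `F j`. -/
def pullback [Fintype τ] (F : τ → MvPolynomial σ R) (α : Form1 τ R) : Form1 σ R :=
  ∑ j, aeval F (α j) • differential (F j)

/-- The ideal `J(α)` generated by the coefficients of a 1-form `α`. -/
def singIdeal (α : Form1 σ R) : Ideal (MvPolynomial σ R) := Ideal.span (Set.range α)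

/-- The ideal `𝒞(β)` generated by the coefficients of a 2-form `β`. -/
def coeffIdeal (β : Form2 σ R) : Ideal (MvPolynomial σ R) :=
  Ideal.span {f | ∃ i j, f = β i j}

end Forms

/-! ### Simplicial complete toric varieties -/

/-- The cone in `ℝ^q` spanned by the vectors `v i`, `i ∈ s`. -/
def coneOver {q m : ℕ} (v : Fin m → Fin q → ℤ) (s : Finset (Fin m)) : Set (Fin q → ℝ) :=
  {x | ∃ c : Fin m → ℝ, (∀ i, 0 ≤ c i) ∧ (∀ i, i ∉ s → c i = 0) ∧
    ∀ j, x j = ∑ i, c i * (v i j : ℝ)}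

/-- A simplicial complete fan in `ℝ^q` with `m` rays, that is, a simplicial complete toric variety
of dimension `q`. The ray generators are `ray i`, and a cone `σ` is recorded by `σ(1)`, the set of
indices of its rays. -/
structure SimplicialCompleteFan (q m : ℕ) where
  ray : Fin m → Fin q → ℤ
  cones : Set (Finset (Fin m))
  /-- the generators are primitive lattice vectors -/
  primitive : ∀ i, ∀ d : ℤ, (∀ j, d ∣ ray i j) → IsUnit d
  ray_mem : ∀ i, {i} ∈ cones
  face_mem : ∀ s ∈ cones, ∀ t, t ⊆ s → t ∈ cones
  simplicial : ∀ s ∈ cones, LinearIndependent ℝ (fun i : s => fun j => (ray i j : ℝ))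
  inter : ∀ s ∈ cones, ∀ t ∈ cones,
    coneOver ray s ∩ coneOver ray t = coneOver ray (s ∩ t)
  complete : ∀ x : Fin q → ℝ, ∃ s ∈ cones, x ∈ coneOver ray s

namespace SimplicialCompleteFan

variable {q m : ℕ} (X : SimplicialCompleteFan q m)

/-- The principal torus invariant divisors `∑ i, ⟨u, v_i⟩ D_i`, `u ∈ ℤ^q`. -/
def principalDivisors : Submodule ℤ (Fin m → ℤ) :=
  LinearMap.range (Matrix.mulVecLin (Matrix.of X.ray))

/-- The class group `Cl(X) = ℤ^m / {principal divisors}`, which grades the homogeneous coordinate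
ring `S_X = ℂ[z_1, …, z_m]`. -/
abbrev ClassGroup : Type := (Fin m → ℤ) ⧸ X.principalDivisors

/-- The degree in `Cl(X)` of the monomial `z ^ s`; that of `z_i` is the class of `D_i`. -/
def monomialDegree (s : Fin m →₀ ℕ) : X.ClassGroup :=
  X.principalDivisors.mkQ (fun i => (s i : ℤ))

/-- `a` is a relation among the rays: `∑ i, a_i v_i = 0`. -/
def IsRelation (a : Fin m → ℤ) : Prop := ∑ i, a i • X.ray i = 0

/-- `α ∈ H⁰(X, Ω̂¹_X(D))` in homogeneous coordinates: `α = ∑ A_i dz_i` is homogeneous of degree `D`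
(so `A_i` is homogeneous of degree `D - [D_i]`), and its contraction with the radial vector field
`∑ a_i z_i ∂/∂z_i` is zero for every relation `a` among the rays. -/
def IsTwistedForm (D : X.ClassGroup) (α : Form1 (Fin m) ℂ) : Prop :=
  (∀ i s, coeff s (α i) ≠ 0 → X.monomialDegree (s + Finsupp.single i 1) = D) ∧
  ∀ a, X.IsRelation a → ∑ i, C (a i : ℂ) * MvPolynomial.X i * α i = 0

/-- `α ∈ ℱ₁(X, D)`: a twisted 1-form of degree `D` that is integrable and whose singular set has
codimension at least two (the irrelevant locus has codimension at least two as well, so this can be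
read off from `J(α)`). -/
def IsFoliation (D : X.ClassGroup) (α : Form1 (Fin m) ℂ) : Prop :=
  X.IsTwistedForm D α ∧ wedgeTwo α (extD α) = 0 ∧ 2 ≤ (singIdeal α).height

/-- The irrelevant locus `Z ⊆ ℂ^m`, so that `X = (ℂ^m ∖ Z) / G`: the zero set of the monomials
`∏_{i ∉ σ(1)} z_i`, `σ` a cone. -/
def irrelevantLocus : Set (Fin m → ℂ) :=
  {z | ∀ s ∈ X.cones, ∏ i ∈ sᶜ, z i = 0}

/-- The point `x ∈ ℂ^{n+1} ∖ {0}` represents a critical point of the rational map `ℙ^n ⇢ X` with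
polynomial lifting `F`: the map is defined there, and its differential
`T ℂ^{n+1} → T ℂ^m → T X = T ℂ^m / (tangent space of the G-orbit)` is not surjective. -/
def IsCriticalPoint {n : ℕ} (F : Fin m → MvPolynomial (Fin (n + 1)) ℂ)
    (x : Fin (n + 1) → ℂ) : Prop :=
  x ≠ 0 ∧ (fun k => eval x (F k)) ∉ X.irrelevantLocus ∧
  Submodule.span ℂ
    ({w | ∃ l, w = fun k => eval x (pderiv l (F k))} ∪
      {w | ∃ a, X.IsRelation a ∧ w = fun k => (a k : ℂ) * eval x (F k)}) ≠
    (⊤ : Submodule ℂ (Fin m → ℂ))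

end SimplicialCompleteFan

/-! ### Twisted 1-forms on projective space, deformations and unfoldings -/

section Projective

variable {n : ℕ}

/-- `H⁰(ℙ^n, Ω¹(ℓ))`: the 1-forms on `ℂ^{n+1}` that are homogeneous of degree `ℓ` (the `dx_i` having
degree one) and have zero contraction with the radial vector field `∑ x_i ∂/∂x_i`. -/
def twistedForms (n ℓ : ℕ) : Submodule ℂ (Form1 (Fin (n + 1)) ℂ) where
  carrier := {η | (∀ i s, coeff s (η i) ≠ 0 → s.degree + 1 = ℓ) ∧
    ∑ i, X i * η i = 0}
  zero_mem' := by simp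
  add_mem' := by
    rintro a b ⟨ha, ha'⟩ ⟨hb, hb'⟩
    refine ⟨fun i s hs => ?_, ?_⟩
    · by_cases h : coeff s (a i) = 0
      · refine hb i s fun h' => hs ?_
        simp [h, h']
      · exact ha i s h
    · simp [mul_add, Finset.sum_add_distrib, ha', hb']
  smul_mem' := by
    rintro c a ⟨ha, ha'⟩
    refine ⟨fun i s hs => ha i s fun h => hs (by simp [h]), ?_⟩
    simp only [Pi.smul_apply, mul_smul_comm, ← Finset.smul_sum, ha', smul_zero]

/-- `ω ∈ ℱ₁(ℙ^n, ℓ)`. -/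
def IsProjFoliation (ℓ : ℕ) (ω : Form1 (Fin (n + 1)) ℂ) : Prop :=
  ω ∈ twistedForms n ℓ ∧ wedgeTwo ω (extD ω) = 0 ∧ 2 ≤ (singIdeal ω).height

/-- The twisted forms `η ∈ H⁰(ℙ^n, Ω¹(ℓ))` with `ω ∧ dη + η ∧ dω = 0`. -/
def deformationForms (ℓ : ℕ) (ω : Form1 (Fin (n + 1)) ℂ) :
    Submodule ℂ (Form1 (Fin (n + 1)) ℂ) where
  carrier := {η | η ∈ twistedForms n ℓ ∧
    wedgeTwo ω (extD η) + wedgeTwo η (extD ω) = 0}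
  zero_mem' := by
    refine ⟨zero_mem _, ?_⟩
    funext i j k
    simp [wedgeTwo, extD]
  add_mem' := by
    rintro a b ⟨ha, ha'⟩ ⟨hb, hb'⟩
    refine ⟨add_mem ha hb, ?_⟩
    have key : wedgeTwo ω (extD (a + b)) + wedgeTwo (a + b) (extD ω) =
        (wedgeTwo ω (extD a) + wedgeTwo a (extD ω)) +
        (wedgeTwo ω (extD b) + wedgeTwo b (extD ω)) := by
      funext i j k
      simp only [wedgeTwo, extD, Pi.add_apply, map_add]
      ring
    rw [key, ha', hb', add_zero]
  smul_mem' := by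
    rintro c a ⟨ha, ha'⟩
    refine ⟨Submodule.smul_mem _ c ha, ?_⟩
    have key : wedgeTwo ω (extD (c • a)) + wedgeTwo (c • a) (extD ω) =
        c • (wedgeTwo ω (extD a) + wedgeTwo a (extD ω)) := by
      funext i j k
      simp only [wedgeTwo, extD, Pi.add_apply, Pi.smul_apply, smul_eq_C_mul, pderiv_C_mul]
      ring
    rw [key, ha', smul_zero]

/-- The space `D(ω)` of first order deformations of `ω`: the forms above modulo `ω`. -/
abbrev Deformations (ℓ : ℕ) (ω : Form1 (Fin (n + 1)) ℂ) : Type :=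
  deformationForms ℓ ω ⧸ (Submodule.span ℂ {ω}).submoduleOf (deformationForms ℓ ω)

/-- The pair `(h, η)` defines a first order unfolding `ω + εη + h dε` of `ω`: `h` is homogeneous of
degree `ℓ`, `η ∈ H⁰(ℙ^n, Ω¹(ℓ))` and `h dω = ω ∧ (η - dh)`. -/
def IsUnfolding (ℓ : ℕ) (ω : Form1 (Fin (n + 1)) ℂ)
    (h : MvPolynomial (Fin (n + 1)) ℂ) (η : Form1 (Fin (n + 1)) ℂ) : Prop :=
  h.IsHomogeneous ℓ ∧ η ∈ twistedForms n ℓ ∧ h • extD ω = wedge ω (η - differential h)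

/-- `D_U(ω) ⊆ D(ω)`: the first order deformations that come from first order unfoldings, i.e. the
image of `(h, η) ↦ η`. -/
def unfoldingDeformations (ℓ : ℕ) (ω : Form1 (Fin (n + 1)) ℂ) : Set (Deformations ℓ ω) :=
  {c | ∃ h, ∃ η : deformationForms ℓ ω, IsUnfolding ℓ ω h η ∧ Submodule.Quotient.mk η = c}

/-- The subscheme of projective space defined by the homogeneous ideal `J` is reduced at the point
represented by `x`. It is equivalent to ask this of the affine cone at `x`, as is done here: the
extension of `J` to the local ring of `ℂ^{n+1}` at `x` is a radical ideal. -/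
def IsReducedAt (J : Ideal (MvPolynomial (Fin (n + 1)) ℂ)) (x : Fin (n + 1) → ℂ) : Prop :=
  haveI : (RingHom.ker (eval x)).IsPrime := RingHom.ker_isPrime _
  (J.map (algebraMap (MvPolynomial (Fin (n + 1)) ℂ)
    (Localization.AtPrime (RingHom.ker (eval x))))).IsRadical

end Projective

/-- The pair `(F, α)` is generic. -/
structure IsGenericPair {q m n : ℕ} (X : SimplicialCompleteFan q m)
    (F : Fin m → MvPolynomial (Fin (n + 1)) ℂ) (α : Form1 (Fin m) ℂ) : Prop where
  /-- no critical value of `F` is a singular point of `α` -/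
  criticalValues : ∀ x, X.IsCriticalPoint F x → ∃ i, eval (fun k => eval x (F k)) (α i) ≠ 0
  /-- the scheme `Sing(F^*α)` is reduced along the set of critical points of `F` -/
  reduced : ∀ x, X.IsCriticalPoint F x → IsReducedAt (singIdeal (pullback F α)) x
  radical : (singIdeal α).IsRadical
  codim_sing : 2 ≤ (singIdeal α).height
  codim_deriv : 3 ≤ (coeffIdeal (extD α)).height

/-- The form
`τ₂ = ∑_j ∑_k ∂A_j/∂z_k(F) G_k dF_j + ∑_k A_k(F) dG_k`, where `α = ∑ A_j dz_j`. -/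
def mapDeformation {m n : ℕ} (F G : Fin m → MvPolynomial (Fin (n + 1)) ℂ)
    (α : Form1 (Fin m) ℂ) : Form1 (Fin (n + 1)) ℂ :=
  (∑ j, ∑ k, (aeval F (pderiv k (α j)) * G k) • differential (F j)) +
    ∑ k, aeval F (α k) • differential (G k)

/-- Extension of scalars from `ℂ` to the dual numbers `ℂ[ε]`. -/
def toDual {σ : Type*} : MvPolynomial σ ℂ →+* MvPolynomial σ (DualNumber ℂ) :=
  MvPolynomial.map (algebraMap ℂ (DualNumber ℂ))

/-- The family `f + ε g`, over the dual numbers, for families `f`, `g` of complex polynomials. -/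
def addEps {κ σ : Type*} (f g : κ → MvPolynomial σ ℂ) : κ → MvPolynomial σ (DualNumber ℂ) :=
  fun k => toDual (f k) + C DualNumber.eps * toDual (g k)

end

end ToricFoliation

open ToricFoliation

namespace ToricFoliation

open MvPolynomial

/-! ### Commutative algebra -/

section Algebra

/-! By Cartan's formula each G gives an unfolding with h = Σ A_k(F) G_k, whose η is the pulled-back
Lie derivative of α along G. This is one direction.

Conversely, let h dω = ω ∧ (η - dh). The heart is that h lies in the ideal K generated by the
A_k(F). Contracting α ∧ dα = 0 with one and with two coordinate fields, and dividing by ω (its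
singular ideal has height at least 2), puts every h · (dα)_ij(F) in K (`mul_aeval_extD_mem`). By
flatness it then suffices that J(α) : 𝒞(dα) = J(α) (`mem_map_of_forall_mul_mem_of_flat`). This holds
because J(α) is radical and dα vanishes on none of its components
(`exists_extD_notMem_of_mem_minimalPrimes`). Taking components in h = Σ A_k(F) G_k makes G_k of
degree e_k. Then η and the form built from G differ by a scalar multiple of ω, which the Euler
direction G_k = e_k F_k absorbs (`mapDeformation_euler`).

The surface X enters in the statement on components. If dα vanished on V(p), the Jacobian of α would
be symmetric mod p and p would have height at least 3, so the contraction relations would force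
three coordinates into p. A relation supported on such coordinates leaves Jacobian entries only
between opposite weights, while radicality makes each dz_i with z_i in p a combination of the dA_t
at the generic point. Three nonzero weights cannot be matched this way: two of them would share a
single partner, and the rank would be too small. -/

theorem dvd_of_dvd_mul_of_two_le_height {R ι : Type*} [CommRing R] [IsDomain R]
    [IsNoetherianRing R] [UniqueFactorizationMonoid R] {w : ι → R}
    (hw : 2 ≤ (Ideal.span (Set.range w)).height) {a b : R} (ha : a ≠ 0)
    (h : ∀ j, a ∣ b * w j) : a ∣ b := by
  induction a using UniqueFactorizationMonoid.induction_on_prime generalizing b with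
  | h₁ => exact absurd rfl ha
  | h₂ x hx => exact hx.dvd
  | h₃ a p _ hp ih =>
    -- By Krull's principal ideal theorem, a prime dividing every `w j` would bound the height of
    -- their ideal by one.
    have hex : ∃ j, ¬ p ∣ w j := by
      by_contra! hall
      have hle : Ideal.span (Set.range w) ≤ Ideal.span {p} := by
        rw [Ideal.span_le]
        rintro _ ⟨j, rfl⟩
        exact Ideal.mem_span_singleton.2 (hall j)
      have h1 : (Ideal.span {p}).height ≤ 1 := by
        have hprime : (Ideal.span {p}).IsPrime :=
          (Ideal.span_singleton_prime hp.ne_zero).2 hp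
        exact Ideal.height_le_one_of_isPrincipal_of_mem_minimalPrimes (Ideal.span {p}) _
          (by rw [Ideal.minimalPrimes_eq_subsingleton_self]; rfl)
      have := hw.trans ((Ideal.height_mono hle).trans h1)
      exact absurd this (by decide)
    obtain ⟨j, hj⟩ := hex
    obtain ⟨b, rfl⟩ := (hp.dvd_or_dvd ((dvd_mul_right p a).trans (h j))).resolve_right hj
    have ha' : a ≠ 0 := fun h0 => ha (by simp [h0])
    refine mul_dvd_mul_left p (ih ha' fun j => ?_)
    have := h j
    rw [mul_assoc] at this
    exact (mul_dvd_mul_iff_left hp.ne_zero).1 this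

/-- Division of vectors: if the entries of `w` generate an ideal of height at least two, then
every vector proportional to `w` is a multiple of `w`. -/
theorem exists_eq_mul_of_two_le_height {R ι : Type*} [CommRing R] [IsDomain R]
    [IsNoetherianRing R] [UniqueFactorizationMonoid R] {w u : ι → R}
    (hw : 2 ≤ (Ideal.span (Set.range w)).height) (h : ∀ i j, w i * u j = w j * u i) :
    ∃ t, ∀ j, u j = t * w j := by
  have hex : ∃ i, w i ≠ 0 := by
    by_contra! hall
    have : Ideal.span (Set.range w) = ⊥ := by
      rw [Ideal.span_eq_bot]
      rintro _ ⟨i, rfl⟩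
      exact hall i
    rw [this, Ideal.height_bot] at hw
    exact absurd hw (by decide)
  obtain ⟨i, hi⟩ := hex
  obtain ⟨t, ht⟩ := dvd_of_dvd_mul_of_two_le_height hw hi (b := u i) fun j =>
    ⟨u j, by rw [h i j, mul_comm]⟩
  refine ⟨t, fun j => mul_left_cancel₀ hi ?_⟩
  rw [h i j, ht]
  ring

/-- Localized at a minimal prime, a radical ideal becomes the maximal ideal. Otherwise some prime
over `J` inside `p` avoids `x`, against minimality. -/
theorem exists_notMem_mul_mem_of_mem_minimalPrimes {R : Type*} [CommRing R] {J p : Ideal R}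
    (hJ : J.IsRadical) (hp : p ∈ J.minimalPrimes) {x : R} (hx : x ∈ p) :
    ∃ s ∉ p, s * x ∈ J := by
  have := hp.1.1
  by_contra! hall
  have hdisj : Disjoint (J : Set R) (p.primeCompl ⊔ Submonoid.powers x : Submonoid R) := by
    rw [Set.disjoint_left]
    intro y hy hy'
    obtain ⟨s, hs, z, ⟨n, rfl⟩, rfl⟩ := Submonoid.mem_sup.1 hy'
    refine hall s hs (hJ ⟨n, ?_⟩)
    rw [mul_pow]
    rcases n with _ | n
    · simpa using J.mul_mem_left 1 (by
        have : s ∈ J := by simpa using hy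
        exact absurd (hp.1.2 this) hs)
    · have : s ^ (n + 1) * x ^ (n + 1) = s ^ n * (s * x ^ (n + 1)) := by ring
      rw [this]
      exact J.mul_mem_left _ hy
  obtain ⟨q, hq, hJq, hqd⟩ := Ideal.exists_le_prime_disjoint J _ hdisj
  have hqp : q ≤ p := fun y hy => by
    by_contra hyp
    exact Set.disjoint_left.1 hqd hy (Submonoid.mem_sup_left (show y ∈ p.primeCompl from hyp))
  exact Set.disjoint_left.1 hqd (hp.2 ⟨hq, hJq⟩ hqp hx)
    (Submonoid.mem_sup_right (Submonoid.mem_powers x))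

/-- A radical ideal is the intersection of its minimal primes, and modulo each of them some `c l`
can be cancelled. -/
theorem mem_of_forall_mul_mem_of_isRadical {R κ : Type*} [CommRing R] {J : Ideal R}
    (hJ : J.IsRadical) {c : κ → R} (hc : ∀ p ∈ J.minimalPrimes, ∃ l, c l ∉ p) {r : R}
    (hr : ∀ l, r * c l ∈ J) : r ∈ J := by
  rw [← hJ.radical, ← Ideal.sInf_minimalPrimes, Ideal.mem_sInf]
  intro p hp
  obtain ⟨l, hl⟩ := hc p hp
  exact (hp.1.1.mem_or_mem (hp.1.2 (hr l))).resolve_right hl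

/-- Formation of the colon ideal `J : (c_l)` commutes with flat base change, in the case where the
colon ideal is `J`. -/
theorem mem_map_of_forall_mul_mem_of_flat {R S ι κ : Type*} [CommRing R] [CommRing S]
    [Algebra R S] [Module.Flat R S] [Fintype ι] [Fintype κ] (a : ι → R) (c : κ → R)
    (hcol : ∀ r, (∀ l, r * c l ∈ Ideal.span (Set.range a)) → r ∈ Ideal.span (Set.range a))
    {h : S} (hh : ∀ l, h * algebraMap R S (c l) ∈
      Ideal.span (Set.range fun i => algebraMap R S (a i))) :
    h ∈ Ideal.span (Set.range fun i => algebraMap R S (a i)) := by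
  classical
  choose u hu using fun l => (Ideal.mem_span_range_iff_exists_fun).1 (hh l)
  -- The equations h c_l = Σ_j u_lj a_j form a linear system over `R` solved in `S` by `h` (slot
  -- `none`) and the `u l j`.
  let x : (Option (ι × κ) → R) →ₗ[R] S :=
    Fintype.linearCombination R (fun o => o.elim h fun jl => u jl.2 jl.1)
  let f : (κ → R) →ₗ[R] (Option (ι × κ) → R) :=
    Fintype.linearCombination R fun l =>
      Pi.single none (c l) - ∑ j, Pi.single (some (j, l)) (a j)
  have hx : ∀ o (r : R), x (Pi.single o r) = r • o.elim h fun jl => u jl.2 jl.1 := fun o r => by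
    simp [x, Fintype.linearCombination_apply_single]
  have hf : ∀ l, f (Pi.single l 1) = Pi.single none (c l) - ∑ j, Pi.single (some (j, l)) (a j) :=
    fun l => by simp [f, Fintype.linearCombination_apply_single]
  have hxf : x ∘ₗ f = 0 := by
    refine LinearMap.pi_ext' fun l => LinearMap.ext_ring ?_
    simp only [LinearMap.comp_apply, LinearMap.single_apply, hf, map_sub, map_sum, hx,
      LinearMap.zero_apply, Option.elim_none, Option.elim_some, Algebra.smul_def, sub_eq_zero]
    rw [mul_comm, ← hu l]
    exact Finset.sum_congr rfl fun j _ => mul_comm _ _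
  -- Equational criterion: the solution over `S` is a combination of solutions over `R`. In each of
  -- these the `none` entry lies in the colon ideal, hence in the span of `a`.
  obtain ⟨k, g, y, hxy, hgf⟩ := Module.Flat.exists_factorization_of_comp_eq_zero_of_free hxf
  have hmem : ∀ t, g (Pi.single none 1) t ∈ Ideal.span (Set.range a) := by
    intro t
    refine hcol _ fun l => ?_
    have h1 := DFunLike.congr_fun (LinearMap.congr_fun hgf (Pi.single l 1)) t
    have hs : ∀ o (r : R), g (Pi.single o r) = r • g (Pi.single o 1) := fun o r => by
      rw [← map_smul, ← Pi.single_smul', smul_eq_mul, mul_one]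
    rw [LinearMap.comp_apply, hf, map_sub, map_sum, hs, Finsupp.sub_apply, Finsupp.smul_apply,
      LinearMap.zero_apply, Finsupp.zero_apply, sub_eq_zero, Finsupp.finsetSum_apply,
      smul_eq_mul, mul_comm] at h1
    rw [h1]
    refine Ideal.sum_mem _ fun j _ => ?_
    rw [hs, Finsupp.smul_apply, smul_eq_mul]
    exact Ideal.mul_mem_right _ _ (Ideal.subset_span ⟨j, rfl⟩)
  have hh' : h = y (g (Pi.single none 1)) := by
    have := hx none 1
    rw [hxy] at this
    simpa using this.symm
  rw [hh', ← Finsupp.univ_sum_single (g (Pi.single none 1)), map_sum]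
  refine Ideal.sum_mem _ fun t _ => ?_
  have : Finsupp.single t (g (Pi.single none 1) t) =
      g (Pi.single none 1) t • Finsupp.single t (1 : R) := by simp
  rw [this, map_smul, Algebra.smul_def]
  refine Ideal.mul_mem_right _ _ ?_
  have h2 := Ideal.mem_map_of_mem (algebraMap R S) (hmem t)
  rwa [Ideal.map_span, ← Set.range_comp] at h2

end Algebra

/-! ### Relations among the rays of a complete fan in the plane -/

namespace SimplicialCompleteFan

section Plane

variable {m : ℕ} (X : SimplicialCompleteFan 2 m)

/-- The determinant of a pair of ray generators of a fan in the plane. -/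
def rayDet (i j : Fin m) : ℤ := X.ray i 0 * X.ray j 1 - X.ray i 1 * X.ray j 0

/-- The relation among three rays given by Cramer's rule. -/
def cramerRelation (i j k : Fin m) : Fin m → ℤ :=
  Pi.single i (X.rayDet j k) + Pi.single j (X.rayDet k i) + Pi.single k (X.rayDet i j)

theorem isRelation_cramerRelation (i j k : Fin m) : X.IsRelation (X.cramerRelation i j k) := by
  simp only [IsRelation, cramerRelation, Pi.add_apply, add_smul, Finset.sum_add_distrib,
    Pi.single_apply, ite_smul, zero_smul, Finset.sum_ite_eq', Finset.mem_univ, if_true]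
  funext c
  fin_cases c <;> simp [rayDet] <;> ring

theorem ray_ne_zero {q m : ℕ} (X : SimplicialCompleteFan q m) (i : Fin m) : X.ray i ≠ 0 := by
  intro h
  have := X.primitive i 0 (fun j => by simp [h])
  simp at this

/-- If all rays lay on one line, the cones could not cover the plane. The test point is `ray i`
turned by a right angle. -/
theorem exists_rayDet_ne_zero (i : Fin m) : ∃ j, X.rayDet i j ≠ 0 := by
  by_contra! hall
  obtain ⟨s, -, c, -, -, hc⟩ := X.complete ![-(X.ray i 1 : ℝ), (X.ray i 0 : ℝ)]
  have h0 := hc 0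
  have h1 := hc 1
  simp only [Matrix.cons_val_zero, Matrix.cons_val_one] at h0 h1
  have key : (X.ray i 0 : ℝ) * X.ray i 0 + (X.ray i 1 : ℝ) * X.ray i 1 =
      ∑ j, c j * (X.rayDet i j : ℝ) := by
    have : ∑ j, c j * (X.rayDet i j : ℝ) = (X.ray i 0 : ℝ) * ∑ j, c j * (X.ray j 1 : ℝ) -
        (X.ray i 1 : ℝ) * ∑ j, c j * (X.ray j 0 : ℝ) := by
      rw [Finset.mul_sum, Finset.mul_sum, ← Finset.sum_sub_distrib]
      refine Finset.sum_congr rfl fun j _ => ?_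
      simp only [rayDet]; push_cast; ring
    rw [this, ← h0, ← h1]; ring
  simp only [hall, Int.cast_zero, mul_zero, Finset.sum_const_zero] at key
  have e0 : (X.ray i 0 : ℝ) = 0 := by
    nlinarith [mul_self_nonneg (X.ray i 0 : ℝ), mul_self_nonneg (X.ray i 1 : ℝ)]
  have e1 : (X.ray i 1 : ℝ) = 0 := by
    nlinarith [mul_self_nonneg (X.ray i 0 : ℝ), mul_self_nonneg (X.ray i 1 : ℝ)]
  refine X.ray_ne_zero i (funext fun c => ?_)
  fin_cases c
  · exact_mod_cast e0
  · exact_mod_cast e1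

theorem nonempty_rays (X : SimplicialCompleteFan 2 m) : Nonempty (Fin m) := by
  by_contra hm
  rw [not_nonempty_iff] at hm
  obtain ⟨s, -, c, -, -, hc⟩ := X.complete fun _ => 1
  simpa using hc 0

theorem coneOver_singleton_inter {q m : ℕ} (X : SimplicialCompleteFan q m) {i j : Fin m}
    (hij : i ≠ j) {x : Fin q → ℝ} (hi : x ∈ coneOver X.ray {i}) (hj : x ∈ coneOver X.ray {j}) :
    x = 0 := by
  have h := X.inter {i} (X.ray_mem i) {j} (X.ray_mem j)
  rw [Finset.singleton_inter_of_notMem (by simpa using hij)] at h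
  obtain ⟨c, -, hc, hx⟩ := h.subset ⟨hi, hj⟩
  funext l
  simp [hx l, hc]

theorem mem_coneOver_singleton {q m : ℕ} (X : SimplicialCompleteFan q m) (i : Fin m) {r : ℝ}
    (hr : 0 ≤ r) : (fun l => r * (X.ray i l : ℝ)) ∈ coneOver X.ray {i} := by
  refine ⟨Pi.single i r, fun j => ?_, fun j hj => ?_, fun l => ?_⟩
  · by_cases h : j = i
    · subst h; simpa
    · simp [h]
  · simp only [Finset.mem_singleton] at hj
    simp [hj]
  · simp [Pi.single_apply]

/-- Two distinct rays that are linearly dependent are opposite to each other. -/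
theorem exists_pos_relation {i j : Fin m} (hij : i ≠ j) (hd : X.rayDet i j = 0) :
    ∃ x y : ℤ, 0 < x ∧ 0 < y ∧ X.IsRelation (Pi.single i x + Pi.single j y) := by
  obtain ⟨c, hc⟩ := Function.ne_iff.1 (X.ray_ne_zero i)
  simp only [Pi.zero_apply] at hc
  have hprop : ∀ l, X.ray i c * X.ray j l = X.ray j c * X.ray i l := by
    simp only [rayDet] at hd
    intro l
    fin_cases c <;> fin_cases l <;> simp <;> linarith
  have hjc : X.ray j c ≠ 0 := by
    intro h0
    refine X.ray_ne_zero j (funext fun l => ?_)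
    have := hprop l
    rw [h0, zero_mul] at this
    exact (mul_eq_zero.1 this).resolve_left hc
  -- A positive ratio would put `ray j` on the half-line of `ray i`, but distinct one-dimensional
  -- cones meet only at the origin.
  have hneg : X.ray i c * X.ray j c < 0 := by
    by_contra hpos
    have hpos : (0 : ℝ) ≤ (X.ray i c : ℝ) * X.ray j c := by exact_mod_cast not_lt.1 hpos
    have hc' : (X.ray i c : ℝ) ≠ 0 := by exact_mod_cast hc
    have hr : (0 : ℝ) ≤ X.ray j c / X.ray i c := by
      have : (X.ray j c : ℝ) / X.ray i c =
          (X.ray i c : ℝ) * X.ray j c / (X.ray i c * X.ray i c) := by field_simp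
      rw [this]
      exact div_nonneg hpos (mul_self_nonneg _)
    have hi := X.mem_coneOver_singleton i hr
    have hj := X.mem_coneOver_singleton j zero_le_one
    have heq : (fun l => (X.ray j c : ℝ) / X.ray i c * (X.ray i l : ℝ)) =
        fun l => (1 : ℝ) * (X.ray j l : ℝ) := by
      funext l
      have : (X.ray i c : ℝ) * X.ray j l = X.ray j c * X.ray i l := by exact_mod_cast hprop l
      field_simp
      linarith
    rw [heq] at hi
    have := congr_fun (X.coneOver_singleton_inter hij hi hj) c
    simp only [one_mul, Pi.zero_apply, Int.cast_eq_zero] at this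
    exact hjc this
  refine ⟨|X.ray j c|, |X.ray i c|, abs_pos.2 hjc, abs_pos.2 hc, ?_⟩
  simp only [IsRelation, Pi.add_apply, add_smul, Finset.sum_add_distrib,
    Pi.single_apply, ite_smul, zero_smul, Finset.sum_ite_eq', Finset.mem_univ, if_true]
  funext l
  have := hprop l
  simp only [Pi.add_apply, Pi.smul_apply, smul_eq_mul, Pi.zero_apply]
  rcases lt_or_gt_of_ne hc with h | h
  · have h2 : 0 < X.ray j c := by nlinarith
    rw [abs_of_pos h2, abs_of_neg h]; linarith
  · have h2 : X.ray j c < 0 := by nlinarith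
    rw [abs_of_neg h2, abs_of_pos h]; linarith

/-! ### The minimal primes of the singular ideal -/

variable {X} {α : Form1 (Fin m) ℂ} {p : Ideal (MvPolynomial (Fin m) ℂ)}

/-- If at most two of the coordinates vanish on `p`, and the corresponding rays are independent,
then a minimal prime of the singular ideal has height at most two. -/
theorem height_le_two_of_rayDet_ne_zero
    (hcontr : ∀ a, X.IsRelation a → ∑ i, C (a i : ℂ) * MvPolynomial.X i * α i = 0)
    (hp : p ∈ (singIdeal α).minimalPrimes) {i j : Fin m} (hd : X.rayDet i j ≠ 0)
    (hX : ∀ k, k ≠ i → k ≠ j → (MvPolynomial.X k : MvPolynomial (Fin m) ℂ) ∉ p) :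
    p.height ≤ 2 := by
  classical
  have hmem : ∀ k, α k ∈ p := fun k => hp.1.2 (Ideal.subset_span ⟨k, rfl⟩)
  -- It is enough that `p` is minimal over two elements. Cramer's relation puts `rayDet i j` · z_k
  -- α_k in the ideal of `α i` and `α j`, and z_k is not in `p`, so not in any smaller prime.
  have hmin : p ∈ (Ideal.span (({α i, α j} : Finset (MvPolynomial (Fin m) ℂ)) :
      Set (MvPolynomial (Fin m) ℂ))).minimalPrimes := by
    refine ⟨⟨hp.1.1, Ideal.span_le.2 ?_⟩, fun q hq hqp => hp.2 ⟨hq.1, ?_⟩ hqp⟩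
    · intro f hf
      simp only [Finset.coe_insert, Finset.coe_singleton, Set.mem_insert_iff,
        Set.mem_singleton_iff] at hf
      rcases hf with rfl | rfl <;> exact hmem _
    · have hi : α i ∈ q := hq.2 (Ideal.subset_span (by simp))
      have hj : α j ∈ q := hq.2 (Ideal.subset_span (by simp))
      have := hq.1
      refine Ideal.span_le.2 ?_
      rintro _ ⟨k, rfl⟩
      by_cases hki : k = i
      · rwa [hki]
      by_cases hkj : k = j
      · rwa [hkj]
      have h := hcontr _ (X.isRelation_cramerRelation i j k)
      have hk : C (X.rayDet i j : ℂ) * MvPolynomial.X k * α k ∈ q := by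
        have h' : C (X.rayDet i j : ℂ) * MvPolynomial.X k * α k =
            -(C (X.rayDet j k : ℂ) * MvPolynomial.X i * α i +
              C (X.rayDet k i : ℂ) * MvPolynomial.X j * α j) := by
          rw [eq_neg_iff_add_eq_zero, ← h]
          simp only [cramerRelation, Pi.add_apply, Pi.single_apply, Int.cast_add, map_add, add_mul,
            Finset.sum_add_distrib, Int.cast_ite, Int.cast_zero, apply_ite C, ite_mul, zero_mul,
            map_zero, Finset.sum_ite_eq', Finset.mem_univ, if_true]
          ring
        rw [h']
        exact q.neg_mem (q.add_mem (q.mul_mem_left _ hi) (q.mul_mem_left _ hj))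
      rcases this.mem_or_mem hk with h1 | h1
      · rcases this.mem_or_mem h1 with h2 | h2
        · exact absurd (Ideal.eq_top_of_isUnit_mem _ h2
            ((isUnit_iff_ne_zero.2 (by exact_mod_cast hd)).map C)) this.ne_top
        · exact absurd (hqp h2) (hX k hki hkj)
      · exact h1
  refine (Ideal.height_le_card_of_mem_minimalPrimes_span_finset hmin).trans ?_
  exact_mod_cast Finset.card_le_two

/-- The Jacobian matrix of `α` modulo `p` is compatible with the weights of the stabilizer of a
general point of `V(p)`. -/
theorem pderiv_mem_of_isRelation (hprime : p.IsPrime)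
    (hcontr : ∀ a, X.IsRelation a → ∑ i, C (a i : ℂ) * MvPolynomial.X i * α i = 0)
    (hC : ∀ i j, extD α i j ∈ p) {a : Fin m → ℤ} (ha : X.IsRelation a)
    (hsupp : ∀ i, a i ≠ 0 → (MvPolynomial.X i : MvPolynomial (Fin m) ℂ) ∈ p) {j k : Fin m}
    (hjk : a j + a k ≠ 0) : pderiv k (α j) ∈ p := by
  classical
  -- The contraction identity differentiated in z_j and z_k. Modulo `p` the sum drops out, since a_i
  -- z_i lies in `p` for every i.
  have h0 : ∑ i, C (a i : ℂ) * MvPolynomial.X i * pderiv k (pderiv j (α i)) +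
      (C (a j : ℂ) * pderiv k (α j) + C (a k : ℂ) * pderiv j (α k)) = 0 := by
    have hterm : ∀ i, pderiv k (pderiv j (C (a i : ℂ) * MvPolynomial.X i * α i)) =
        C (a i : ℂ) * MvPolynomial.X i * pderiv k (pderiv j (α i)) +
          ((if i = j then C (a i : ℂ) * pderiv k (α i) else 0) +
            (if i = k then C (a i : ℂ) * pderiv j (α i) else 0)) := by
      intro i
      have e1 : pderiv k (if i = j then (1 : MvPolynomial (Fin m) ℂ) else 0) = 0 := by
        split_ifs <;> simp
      rw [mul_assoc, pderiv_C_mul, pderiv_C_mul, pderiv_mul, map_add, pderiv_mul, pderiv_mul,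
        pderiv_X, pderiv_X]
      simp only [Pi.single_apply, e1]
      split_ifs <;> ring
    have h := congr_arg (fun f => pderiv k (pderiv j f)) (hcontr a ha)
    simpa only [map_zero, map_sum, hterm, Finset.sum_add_distrib, Finset.sum_ite_eq',
      Finset.mem_univ, if_true] using h
  have h1 : C (a j : ℂ) * pderiv k (α j) + C (a k : ℂ) * pderiv j (α k) ∈ p := by
    rw [← neg_eq_iff_add_eq_zero] at h0
    rw [← h0]
    refine p.neg_mem (Ideal.sum_mem _ fun i _ => Ideal.mul_mem_right _ _ ?_)
    by_cases hi : a i = 0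
    · simp [hi]
    · exact p.mul_mem_left _ (hsupp i hi)
  -- The Jacobian is symmetric modulo `p` because dα vanishes there, so the two terms merge.
  have h2 : C ((a j : ℂ) + a k) * pderiv k (α j) ∈ p := by
    have : C ((a j : ℂ) + a k) * pderiv k (α j) =
        (C (a j : ℂ) * pderiv k (α j) + C (a k : ℂ) * pderiv j (α k)) +
          C (a k : ℂ) * extD α k j := by
      simp only [extD, map_add]; ring
    rw [this]
    exact p.add_mem h1 (p.mul_mem_left _ (hC k j))
  refine (hprime.mem_or_mem h2).resolve_left fun h3 => hprime.ne_top ?_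
  exact Ideal.eq_top_of_isUnit_mem _ h3 ((isUnit_iff_ne_zero.2 (by exact_mod_cast hjk)).map C)

/-- The differentials of the coordinates that vanish on `p` are combinations of those of the
coefficients of `α`. -/
theorem exists_sum_mul_pderiv_mem {σ : Type*} [Fintype σ] [DecidableEq σ] {α : Form1 σ ℂ}
    {p : Ideal (MvPolynomial σ ℂ)} (hrad : (singIdeal α).IsRadical)
    (hp : p ∈ (singIdeal α).minimalPrimes) {i : σ}
    (hi : (MvPolynomial.X i : MvPolynomial σ ℂ) ∈ p) :
    ∃ s ∉ p, ∃ c : σ → MvPolynomial σ ℂ,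
      ∀ k, (if k = i then s else 0) - ∑ t, c t * pderiv k (α t) ∈ p := by
  -- Differentiate s z_i = Σ c_t α_t and discard the terms retaining a factor z_i or α_t, all in
  -- `p`.
  obtain ⟨s, hs, h⟩ := exists_notMem_mul_mem_of_mem_minimalPrimes hrad hp hi
  obtain ⟨c, hc⟩ := Ideal.mem_span_range_iff_exists_fun.1 h
  refine ⟨s, hs, c, fun k => ?_⟩
  have h1 := congr_arg (pderiv k) hc
  simp only [map_sum, Derivation.leibniz, smul_eq_mul, pderiv_X, Finset.sum_add_distrib,
    Pi.single_apply, mul_ite, mul_one, mul_zero] at h1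
  have h2 : (if k = i then s else 0) - ∑ t, c t * pderiv k (α t) =
      ∑ t, α t * pderiv k (c t) - MvPolynomial.X i * pderiv k s := by
    have : (if k = i then s else 0) = if i = k then s else 0 := by simp only [eq_comm]
    rw [this]
    linear_combination -h1
  rw [h2]
  exact p.sub_mem (Ideal.sum_mem _ fun t _ =>
    p.mul_mem_right _ (hp.1.2 (Ideal.subset_span ⟨t, rfl⟩))) (p.mul_mem_right _ hi)

/-- Under the genericity conditions, the exterior derivative of `α` does not vanish identically on
any component of the singular scheme. -/
theorem exists_extD_notMem_of_mem_minimalPrimes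
    (hcontr : ∀ a, X.IsRelation a → ∑ i, C (a i : ℂ) * MvPolynomial.X i * α i = 0)
    (hrad : (singIdeal α).IsRadical) (hht : 3 ≤ (coeffIdeal (extD α)).height)
    (hp : p ∈ (singIdeal α).minimalPrimes) : ∃ i j, extD α i j ∉ p := by
  classical
  by_contra! hC
  have hprime := hp.1.1
  have hmem : ∀ k, α k ∈ p := fun k => hp.1.2 (Ideal.subset_span ⟨k, rfl⟩)
  have hp3 : 3 ≤ p.height := by
    refine hht.trans (Ideal.height_mono (Ideal.span_le.2 ?_))
    rintro _ ⟨i, j, rfl⟩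
    exact hC i j
  have hsmall : ∀ i j, X.rayDet i j ≠ 0 →
      ∃ k, k ≠ i ∧ k ≠ j ∧ (MvPolynomial.X k : MvPolynomial (Fin m) ℂ) ∈ p := by
    intro i j hd
    by_contra! h
    exact absurd (hp3.trans (height_le_two_of_rayDet_ne_zero hcontr hp hd h)) (by decide)
  have hrow := fun {i} => exists_sum_mul_pderiv_mem (i := i) hrad hp
  have hweight := fun {a} (ha : X.IsRelation a) hsupp {j k} =>
    pderiv_mem_of_isRelation (j := j) (k := k) hprime hcontr hC ha hsupp
  -- With no index of weight -a_i, column i of the Jacobian vanishes mod `p`, and dz_i cannot be a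
  -- combination of the dα_t.
  have hpartner : ∀ {a : Fin m → ℤ}, X.IsRelation a →
      (∀ i, a i ≠ 0 → (MvPolynomial.X i : MvPolynomial (Fin m) ℂ) ∈ p) →
      ∀ i, (MvPolynomial.X i : MvPolynomial (Fin m) ℂ) ∈ p → ∃ t, a t = -a i := by
    intro a ha hsupp i hi
    by_contra! hall
    obtain ⟨s, hs, c, hc⟩ := hrow hi
    have h1 := hc i
    rw [if_pos rfl] at h1
    refine hs ((Submodule.sub_mem_iff_left p (Ideal.sum_mem _ fun t _ => p.mul_mem_left _ ?_)).1 h1)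
    exact hweight ha hsupp fun h => hall t (eq_neg_of_add_eq_zero_left h)
  -- Columns i and j would be supported in the single row k, so they have rank at most one and
  -- cannot yield both dz_i and dz_j.
  have hunique : ∀ {a : Fin m → ℤ}, X.IsRelation a →
      (∀ i, a i ≠ 0 → (MvPolynomial.X i : MvPolynomial (Fin m) ℂ) ∈ p) →
      ∀ i j k : Fin m, i ≠ j → (MvPolynomial.X i : MvPolynomial (Fin m) ℂ) ∈ p →
      (MvPolynomial.X j : MvPolynomial (Fin m) ℂ) ∈ p → a i = a j →
      (∀ t, a t = -a i → t = k) → False := by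
    intro a ha hsupp i j k hij hi hj haij hk
    have hvan : ∀ t ≠ k, ∀ l, a l = a i → pderiv l (α t) ∈ p := fun t ht l hl =>
      hweight ha hsupp fun h => ht (hk t (by rw [← hl]; exact eq_neg_of_add_eq_zero_left h))
    have hsum : ∀ (c : Fin m → MvPolynomial (Fin m) ℂ) (r : MvPolynomial (Fin m) ℂ) (l : Fin m),
        a l = a i → r - ∑ t, c t * pderiv l (α t) ∈ p → r - c k * pderiv l (α k) ∈ p := by
      intro c r l hl h
      rw [← Finset.add_sum_erase _ _ (Finset.mem_univ k), ← sub_sub] at h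
      refine (Submodule.sub_mem_iff_left p (Ideal.sum_mem _ fun t ht => p.mul_mem_left _ ?_)).1 h
      exact hvan t (Finset.ne_of_mem_erase ht) l hl
    obtain ⟨s, hs, c, hc⟩ := hrow hi
    have h1 := hsum c _ i rfl (hc i)
    have h2 := hsum c _ j haij.symm (hc j)
    rw [if_pos rfl] at h1
    rw [if_neg hij.symm, zero_sub, neg_mem_iff] at h2
    have h3 : pderiv j (α k) ∈ p := (hprime.mem_or_mem h2).resolve_left fun h =>
      hs ((Submodule.sub_mem_iff_left p (p.mul_mem_right _ h)).1 h1)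
    obtain ⟨s', hs', c', hc'⟩ := hrow hj
    have h4 := hsum c' _ j haij.symm (hc' j)
    rw [if_pos rfl] at h4
    exact hs' ((Submodule.sub_mem_iff_left p (p.mul_mem_left _ h3)).1 h4)
  -- Opposite rays satisfy a relation with nonnegative weights, in which a positive weight has no
  -- partner.
  have hindep : ∀ i j, i ≠ j → (MvPolynomial.X i : MvPolynomial (Fin m) ℂ) ∈ p →
      (MvPolynomial.X j : MvPolynomial (Fin m) ℂ) ∈ p → X.rayDet i j ≠ 0 := by
    intro i j hij hi hj hd
    obtain ⟨x, y, hx, hy, hrel⟩ := X.exists_pos_relation hij hd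
    obtain ⟨t, ht⟩ := hpartner hrel (fun k hk => by
      by_cases hki : k = i
      · rwa [hki]
      by_cases hkj : k = j
      · rwa [hkj]
      simp [hki, hkj] at hk) i hi
    simp only [Pi.add_apply, Pi.single_apply] at ht
    split_ifs at ht <;> omega
  have htriple : ∀ i j k, i ≠ j → i ≠ k → j ≠ k →
      (MvPolynomial.X i : MvPolynomial (Fin m) ℂ) ∈ p →
      (MvPolynomial.X j : MvPolynomial (Fin m) ℂ) ∈ p →
      (MvPolynomial.X k : MvPolynomial (Fin m) ℂ) ∈ p → False := by
    intro i j k hij hik hjk hi hj hk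
    have hrel := X.isRelation_cramerRelation i j k
    have ei : X.cramerRelation i j k i = X.rayDet j k := by simp [cramerRelation, hij, hik]
    have ej : X.cramerRelation i j k j = X.rayDet k i := by
      simp [cramerRelation, hij.symm, hjk]
    have ek : X.cramerRelation i j k k = X.rayDet i j := by
      simp [cramerRelation, hik.symm, hjk.symm]
    have eo : ∀ t, t ≠ i → t ≠ j → t ≠ k → X.cramerRelation i j k t = 0 := fun t h1 h2 h3 => by
      simp [cramerRelation, h1, h2, h3]
    have ni := hindep j k hjk hj hk
    have nj := hindep k i hik.symm hk hi
    have nk := hindep i j hij hi hj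
    rw [← ei] at ni
    rw [← ej] at nj
    rw [← ek] at nk
    generalize X.cramerRelation i j k = a at *
    have hsupp : ∀ t, a t ≠ 0 → (MvPolynomial.X t : MvPolynomial (Fin m) ℂ) ∈ p := by
      intro t ht
      by_cases h1 : t = i
      · rwa [h1]
      by_cases h2 : t = j
      · rwa [h2]
      by_cases h3 : t = k
      · rwa [h3]
      exact absurd (eo t h1 h2 h3) ht
    have hcase : ∀ t, t = i ∨ t = j ∨ t = k ∨ a t = 0 := by
      intro t
      by_cases h1 : t = i
      · exact Or.inl h1
      by_cases h2 : t = j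
      · exact Or.inr (Or.inl h2)
      by_cases h3 : t = k
      · exact Or.inr (Or.inr (Or.inl h3))
      exact Or.inr (Or.inr (Or.inr (eo t h1 h2 h3)))
    -- All three weights are nonzero, so the partner of each is one of the other two. Hence two of
    -- the weights agree and the third is their only negative, as `hunique` forbids.
    have hpi : a j = -a i ∨ a k = -a i := by
      obtain ⟨t, ht⟩ := hpartner hrel hsupp i hi
      rcases hcase t with rfl | rfl | rfl | h <;> omega
    have hpj : a i = -a j ∨ a k = -a j := by
      obtain ⟨t, ht⟩ := hpartner hrel hsupp j hj
      rcases hcase t with rfl | rfl | rfl | h <;> omega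
    have hpk : a i = -a k ∨ a j = -a k := by
      obtain ⟨t, ht⟩ := hpartner hrel hsupp k hk
      rcases hcase t with rfl | rfl | rfl | h <;> omega
    by_cases h1 : a i = a j
    · refine hunique hrel hsupp i j k hij hi hj h1 fun t ht => ?_
      rcases hcase t with rfl | rfl | rfl | h <;> first | rfl | omega
    by_cases h2 : a i = a k
    · refine hunique hrel hsupp i k j hik hi hk h2 fun t ht => ?_
      rcases hcase t with rfl | rfl | rfl | h <;> first | rfl | omega
    have h3 : a j = a k := by omega
    refine hunique hrel hsupp j k i hjk hj hk h3 fun t ht => ?_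
    rcases hcase t with rfl | rfl | rfl | h <;> first | rfl | omega
  -- Each independent pair of rays forces a further coordinate into `p`; three uses produce three
  -- distinct ones.
  obtain ⟨i₀⟩ := X.nonempty_rays
  obtain ⟨j₀, hd₀⟩ := X.exists_rayDet_ne_zero i₀
  obtain ⟨i, -, -, hi⟩ := hsmall i₀ j₀ hd₀
  obtain ⟨j₁, hd₁⟩ := X.exists_rayDet_ne_zero i
  obtain ⟨j, hji, -, hj⟩ := hsmall i j₁ hd₁
  obtain ⟨k, hki, hkj, hk⟩ := hsmall i j (hindep i j hji.symm hi hj)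
  exact htriple i j k hji.symm hki.symm hkj.symm hi hj hk

end Plane

end SimplicialCompleteFan

/-! ### Pullbacks of forms and unfoldings -/

section Pullback

variable {σ τ R : Type*} [CommRing R] [Fintype τ]

theorem pderiv_aeval (F : τ → MvPolynomial σ R) (f : MvPolynomial τ R) (l : σ) :
    pderiv l (aeval F f) = ∑ j, aeval F (pderiv j f) * pderiv l (F j) := by
  classical
  induction f using MvPolynomial.induction_on with
  | C a => simp [algebraMap_eq]
  | add p q hp hq =>
    simp only [map_add, hp, hq, add_mul, Finset.sum_add_distrib]
  | mul_X p i hp =>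
    rw [map_mul, aeval_X, pderiv_mul, hp]
    simp only [pderiv_mul, pderiv_X, map_add, map_mul, aeval_X, add_mul, Finset.sum_add_distrib,
      Finset.sum_mul, Pi.single_apply, apply_ite (aeval F), map_zero, mul_ite, mul_one,
      mul_zero, ite_mul, zero_mul, Finset.sum_ite_eq, Finset.mem_univ, if_true]
    congr 1
    exact Finset.sum_congr rfl fun j _ => by ring

theorem pullback_apply (F : τ → MvPolynomial σ R) (α : Form1 τ R) (l : σ) :
    pullback F α l = ∑ j, aeval F (α j) * pderiv l (F j) := by
  simp [pullback, differential]

theorem pderiv_pderiv_comm (l k : σ) (f : MvPolynomial σ R) :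
    pderiv l (pderiv k f) = pderiv k (pderiv l f) := by
  classical
  have h : ⁅(pderiv l : Derivation R (MvPolynomial σ R) (MvPolynomial σ R)),
      (pderiv k : Derivation R (MvPolynomial σ R) (MvPolynomial σ R))⁆ = 0 := by
    refine derivation_ext fun i => ?_
    rw [Derivation.commutator_apply, pderiv_X, pderiv_X]
    simp only [Pi.single_apply]
    split_ifs <;> simp
  have h' := DFunLike.congr_fun h f
  rw [Derivation.commutator_apply] at h'
  exact sub_eq_zero.1 h'

theorem pderiv_pullback_apply (F : τ → MvPolynomial σ R) (α : Form1 τ R) (l k : σ) :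
    pderiv l (pullback F α k) =
      ∑ i, ∑ j, aeval F (pderiv i (α j)) * (pderiv l (F i) * pderiv k (F j)) +
        ∑ j, aeval F (α j) * pderiv l (pderiv k (F j)) := by
  have h : ∀ j, pderiv l (aeval F (α j) * pderiv k (F j)) =
      (∑ i, aeval F (pderiv i (α j)) * (pderiv l (F i) * pderiv k (F j))) +
        aeval F (α j) * pderiv l (pderiv k (F j)) := by
    intro j
    rw [pderiv_mul, pderiv_aeval, Finset.sum_mul]
    simp only [mul_assoc]
  rw [pullback_apply, map_sum]
  simp only [h]
  rw [Finset.sum_add_distrib, Finset.sum_comm]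

theorem aeval_extD {σ τ R : Type*} [CommRing R] (F : τ → MvPolynomial σ R)
    (α : Form1 τ R) (i j : τ) :
    aeval F (extD α i j) = aeval F (pderiv i (α j)) - aeval F (pderiv j (α i)) :=
  map_sub _ _ _

/-- Pullback commutes with d: the second derivatives of `F` cancel by symmetry. -/
theorem extD_pullback_apply (F : τ → MvPolynomial σ R) (α : Form1 τ R) (l k : σ) :
    extD (pullback F α) l k =
      ∑ i, ∑ j, aeval F (extD α i j) * (pderiv l (F i) * pderiv k (F j)) := by
  have hcomm : ∑ j, aeval F (α j) * pderiv l (pderiv k (F j)) =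
      ∑ j, aeval F (α j) * pderiv k (pderiv l (F j)) :=
    Finset.sum_congr rfl fun j _ => by rw [pderiv_pderiv_comm]
  have h : extD (pullback F α) l k =
      pderiv l (pullback F α k) - pderiv k (pullback F α l) := rfl
  rw [h, pderiv_pullback_apply, pderiv_pullback_apply, hcomm, add_sub_add_right_eq_sub,
    Finset.sum_comm (f := fun i j =>
      aeval F (pderiv i (α j)) * (pderiv k (F i) * pderiv l (F j))),
    ← Finset.sum_sub_distrib]
  refine Finset.sum_congr rfl fun i _ => ?_
  rw [← Finset.sum_sub_distrib]
  refine Finset.sum_congr rfl fun j _ => ?_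
  rw [aeval_extD]
  ring

/-- The pullback by `F` of the contraction of `dα` with `∂/∂z_k`. -/
noncomputable def pullbackContraction (F : τ → MvPolynomial σ R) (α : Form1 τ R) (k : τ) :
    Form1 σ R :=
  fun l => ∑ j, aeval F (extD α k j) * pderiv l (F j)

variable {F : τ → MvPolynomial σ R} {α : Form1 τ R}

theorem extD_swap (β : Form1 σ R) (i j : σ) : extD β j i = -extD β i j := by
  simp [extD]

/-- The pullback of the contraction of `α ∧ dα = 0` with `∂/∂z_k`. -/
theorem smul_extD_pullback (hα : wedgeTwo α (extD α) = 0) (k : τ) :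
    aeval F (α k) • extD (pullback F α) =
      wedge (pullback F α) (pullbackContraction F α k) := by
  funext l r
  have hint : ∀ i j, aeval F (α k) * aeval F (extD α i j) =
      aeval F (α i) * aeval F (extD α k j) - aeval F (α j) * aeval F (extD α k i) := by
    intro i j
    have h : α k * extD α i j + α i * extD α j k + α j * extD α k i = 0 :=
      congr_fun (congr_fun (congr_fun hα k) i) j
    have h' := congr_arg (aeval F) h
    rw [extD_swap α k j] at h'
    simp only [map_add, map_mul, map_zero, map_neg] at h'
    linear_combination h'
  simp only [Pi.smul_apply, smul_eq_mul, extD_pullback_apply, wedge, pullback_apply,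
    pullbackContraction, Finset.sum_mul_sum]
  rw [Finset.mul_sum, Finset.sum_comm (f := fun i j => aeval F (α i) * pderiv r (F i) *
    (aeval F (extD α k j) * pderiv l (F j))), ← Finset.sum_sub_distrib]
  refine Finset.sum_congr rfl fun i _ => ?_
  rw [Finset.mul_sum, ← Finset.sum_sub_distrib]
  refine Finset.sum_congr rfl fun j _ => ?_
  linear_combination (pderiv l (F i) * pderiv r (F j)) * hint i j

/-- This is α ∧ dα = 0 contracted with both ∂/∂z_i and ∂/∂z_j, then pulled back. -/
theorem aeval_extD_mul_pullback (hα : wedgeTwo α (extD α) = 0) (i j : τ) (l : σ) :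
    aeval F (extD α i j) * pullback F α l =
      aeval F (α j) * pullbackContraction F α i l -
        aeval F (α i) * pullbackContraction F α j l := by
  simp only [pullback_apply, pullbackContraction, Finset.mul_sum, ← Finset.sum_sub_distrib]
  refine Finset.sum_congr rfl fun k _ => ?_
  have h : α k * extD α i j + α i * extD α j k + α j * extD α k i = 0 :=
    congr_fun (congr_fun (congr_fun hα k) i) j
  have h' := congr_arg (aeval F) h
  rw [extD_swap α i k] at h'
  simp only [map_add, map_mul, map_zero, map_neg] at h'
  linear_combination (pderiv l (F k)) * h'

/-- If `h dω = ω ∧ ξ` for `ω = F^*α`, then `h` multiplies the coefficients of `F^*dα` into the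
ideal generated by the coefficients of `α` along `F`. -/
theorem mul_aeval_extD_mem [IsDomain R] [IsNoetherianRing (MvPolynomial σ R)]
    [UniqueFactorizationMonoid (MvPolynomial σ R)] (hα : wedgeTwo α (extD α) = 0)
    (hht : 2 ≤ (singIdeal (pullback F α)).height) {h : MvPolynomial σ R} {ξ : Form1 σ R}
    (hξ : h • extD (pullback F α) = wedge (pullback F α) ξ) (i j : τ) :
    h * aeval F (extD α i j) ∈ Ideal.span (Set.range fun k => aeval F (α k)) := by
  -- Both terms on the left have the same wedge with ω, namely h A_k(F) dω, so their difference is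
  -- divisible by ω.
  have hdiv : ∀ k, ∃ t, ∀ l, h * pullbackContraction F α k l - aeval F (α k) * ξ l =
      t * pullback F α l := by
    intro k
    refine exists_eq_mul_of_two_le_height (w := pullback F α)
      (u := fun l => h * pullbackContraction F α k l - aeval F (α k) * ξ l) hht fun l r => ?_
    have h1 := congr_fun (congr_fun hξ l) r
    have h2 := congr_fun (congr_fun (smul_extD_pullback (F := F) hα k) l) r
    simp only [Pi.smul_apply, smul_eq_mul, wedge] at h1 h2
    linear_combination aeval F (α k) * h1 - h * h2
  obtain ⟨t, ht⟩ := hdiv i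
  obtain ⟨s, hs⟩ := hdiv j
  have hex : ∃ l, pullback F α l ≠ 0 := by
    by_contra! hall
    have : singIdeal (pullback F α) = ⊥ := by
      rw [singIdeal, Ideal.span_eq_bot]
      rintro _ ⟨l, rfl⟩
      exact hall l
    rw [this, Ideal.height_bot] at hht
    exact absurd hht (by decide)
  obtain ⟨l, hl⟩ := hex
  -- Inserting the two divisions into the twice contracted identity cancels ξ and leaves multiples
  -- of ω.
  have key : h * aeval F (extD α i j) = t * aeval F (α j) - s * aeval F (α i) := by
    refine mul_right_cancel₀ hl ?_
    linear_combination h * aeval_extD_mul_pullback (F := F) hα i j l +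
      aeval F (α j) * ht l - aeval F (α i) * hs l
  rw [key]
  exact Ideal.sub_mem _ (Ideal.mul_mem_left _ _ (Ideal.subset_span ⟨j, rfl⟩))
    (Ideal.mul_mem_left _ _ (Ideal.subset_span ⟨i, rfl⟩))

end Pullback

/-! ### Lie derivatives of α along deformations of the map -/

section MapDeformation

variable {m n : ℕ} {F G : Fin m → MvPolynomial (Fin (n + 1)) ℂ} {α : Form1 (Fin m) ℂ}

theorem mapDeformation_apply (F G : Fin m → MvPolynomial (Fin (n + 1)) ℂ) (α : Form1 (Fin m) ℂ)
    (l : Fin (n + 1)) :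
    mapDeformation F G α l = ∑ j, ((∑ k, aeval F (pderiv k (α j)) * G k) * pderiv l (F j) +
      aeval F (α j) * pderiv l (G j)) := by
  simp [mapDeformation, differential, Finset.sum_add_distrib, Finset.sum_mul]

theorem mapDeformation_add (F G H : Fin m → MvPolynomial (Fin (n + 1)) ℂ)
    (α : Form1 (Fin m) ℂ) :
    mapDeformation F (G + H) α = mapDeformation F G α + mapDeformation F H α := by
  funext l
  simp only [mapDeformation_apply, Pi.add_apply, map_add, ← Finset.sum_add_distrib, mul_add]
  refine Finset.sum_congr rfl fun j _ => ?_
  rw [Finset.sum_add_distrib]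
  ring

theorem mapDeformation_smul (F G : Fin m → MvPolynomial (Fin (n + 1)) ℂ) (c : ℂ)
    (α : Form1 (Fin m) ℂ) :
    mapDeformation F (c • G) α = c • mapDeformation F G α := by
  funext l
  simp only [mapDeformation_apply, Pi.smul_apply, Derivation.map_smul, mul_smul_comm,
    ← Finset.smul_sum, smul_mul_assoc, ← smul_add]

/-- Cartan's formula for the Lie derivative of `α` along `G`, pulled back by `F`. -/
theorem mapDeformation_sub_differential (l : Fin (n + 1)) :
    mapDeformation F G α l - differential (∑ k, aeval F (α k) * G k) l =
      ∑ k, G k * pullbackContraction F α k l := by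
  have h1 : differential (∑ k, aeval F (α k) * G k) l =
      ∑ k, ((∑ j, aeval F (pderiv j (α k)) * pderiv l (F j)) * G k +
        aeval F (α k) * pderiv l (G k)) := by
    rw [differential, map_sum]
    exact Finset.sum_congr rfl fun k _ => by rw [pderiv_mul, pderiv_aeval]
  rw [h1, mapDeformation_apply, Finset.sum_add_distrib, Finset.sum_add_distrib,
    add_sub_add_right_eq_sub]
  simp only [Finset.sum_mul]
  rw [Finset.sum_comm, ← Finset.sum_sub_distrib]
  refine Finset.sum_congr rfl fun k _ => ?_
  rw [← Finset.sum_sub_distrib, pullbackContraction, Finset.mul_sum]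
  refine Finset.sum_congr rfl fun j _ => ?_
  rw [aeval_extD]
  ring

/-- Deformations of the map `F` induce first order unfoldings of `F^*α`. -/
theorem smul_extD_pullback_eq_wedge_mapDeformation (hα : wedgeTwo α (extD α) = 0) :
    (∑ k, aeval F (α k) * G k) • extD (pullback F α) =
      wedge (pullback F α)
        (mapDeformation F G α - differential (∑ k, aeval F (α k) * G k)) := by
  funext l r
  simp only [Pi.smul_apply, smul_eq_mul, wedge, Pi.sub_apply, mapDeformation_sub_differential,
    Finset.mul_sum, Finset.sum_mul, ← Finset.sum_sub_distrib]
  refine Finset.sum_congr rfl fun k _ => ?_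
  have h := congr_fun (congr_fun (smul_extD_pullback (F := F) hα k) l) r
  simp only [Pi.smul_apply, smul_eq_mul, wedge] at h
  linear_combination G k * h

/-! ### First order Taylor expansion over the dual numbers -/

theorem eps_mul_eps (σ : Type*) :
    (C DualNumber.eps : MvPolynomial σ (DualNumber ℂ)) * C DualNumber.eps = 0 := by
  rw [← C_mul, DualNumber.eps_mul_eps, C_0]

theorem sum_aeval_pderiv_mul_X (p : MvPolynomial (Fin m) ℂ) (i : Fin m) :
    ∑ k, aeval F (pderiv k (p * X i)) * G k =
      (∑ k, aeval F (pderiv k p) * G k) * F i + aeval F p * G i := by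
  classical
  have h : ∀ k, aeval F (pderiv k (p * X i)) * G k =
      aeval F (pderiv k p) * G k * F i + if i = k then aeval F p * G k else 0 := by
    intro k
    rw [pderiv_mul, pderiv_X, Pi.single_apply, map_add, map_mul, map_mul, aeval_X]
    split_ifs
    · rw [map_one]; ring
    · rw [map_zero]; ring
  simp only [h, Finset.sum_add_distrib, Finset.sum_mul, Finset.sum_ite_eq, Finset.mem_univ,
    if_true]

/-- The coefficient of ε is a derivation along `F`, so induction on `f` needs only Leibniz and ε² =
0. -/
theorem aeval_addEps (f : MvPolynomial (Fin m) ℂ) :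
    aeval (addEps F G) (toDual f) =
      toDual (aeval F f) + C DualNumber.eps * toDual (∑ k, aeval F (pderiv k f) * G k) := by
  induction f using MvPolynomial.induction_on with
  | C a => simp [toDual, algebraMap_eq]
  | add p q hp hq =>
    have hsum : ∑ k, aeval F (pderiv k (p + q)) * G k =
        ∑ k, aeval F (pderiv k p) * G k + ∑ k, aeval F (pderiv k q) * G k := by
      rw [← Finset.sum_add_distrib]
      exact Finset.sum_congr rfl fun k _ => by rw [map_add, map_add, add_mul]
    rw [hsum, map_add toDual, map_add, hp, hq, map_add (aeval F), map_add toDual,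
      map_add toDual]
    ring
  | mul_X p i hp =>
    have hX : aeval (addEps F G) (toDual (X i)) =
        toDual (F i) + C DualNumber.eps * toDual (G i) := by
      simp [toDual, addEps]
    rw [map_mul toDual, map_mul, hp, hX, sum_aeval_pderiv_mul_X, map_mul (aeval F), aeval_X,
      map_add toDual, map_mul toDual, map_mul toDual, map_mul toDual]
    linear_combination (toDual (∑ k, aeval F (pderiv k p) * G k) * toDual (G i)) *
      eps_mul_eps (Fin (n + 1))

theorem addEps_pullback_mapDeformation :
    addEps (pullback F α) (mapDeformation F G α) =
      pullback (addEps F G) (fun j => toDual (α j)) := by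
  have hd : ∀ l (f : MvPolynomial (Fin (n + 1)) ℂ), pderiv l (toDual f) = toDual (pderiv l f) :=
    fun l f => pderiv_map
  funext l
  have h1 : addEps (pullback F α) (mapDeformation F G α) l =
      toDual (pullback F α l) + C DualNumber.eps * toDual (mapDeformation F G α l) := rfl
  rw [h1, pullback_apply, pullback_apply, mapDeformation_apply, map_sum, map_sum, Finset.mul_sum,
    ← Finset.sum_add_distrib]
  refine Finset.sum_congr rfl fun j _ => ?_
  have h2 : pderiv l (addEps F G j) =
      toDual (pderiv l (F j)) + C DualNumber.eps * toDual (pderiv l (G j)) := by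
    rw [← hd, ← hd, ← pderiv_C_mul, ← map_add]
    rfl
  rw [aeval_addEps, h2, map_add toDual, map_mul toDual, map_mul toDual, map_mul toDual]
  linear_combination -(toDual (∑ k, aeval F (pderiv k (α j)) * G k) * toDual (pderiv l (G j))) *
    eps_mul_eps (Fin (n + 1))

end MapDeformation

/-! ### Homogeneity -/

section Homogeneity

theorem isHomogeneous_aeval_of_isWeightedHomogeneous {σ τ : Type*} [Fintype τ] {e : τ → ℕ}
    {F : τ → MvPolynomial σ ℂ} (hF : ∀ k, (F k).IsHomogeneous (e k)) {A : MvPolynomial τ ℂ}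
    {N : ℕ} (hA : A.IsWeightedHomogeneous e N) : (aeval F A).IsHomogeneous N := by
  rw [aeval_def, eval₂_eq']
  refine IsHomogeneous.sum _ _ _ fun s hs => ?_
  refine IsHomogeneous.C_mul ?_ _
  have hN := hA (mem_support_iff.1 hs)
  rw [Finsupp.weight_apply, Finsupp.sum_fintype _ _ (by simp)] at hN
  rw [← hN]
  refine IsHomogeneous.prod _ _ _ fun i _ => ?_
  rw [smul_eq_mul, mul_comm]
  exact (hF i).pow _

theorem homogeneousComponent_mul_of_isHomogeneous {σ : Type*} {p : MvPolynomial σ ℂ} {N : ℕ}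
    (hp : p.IsHomogeneous N) (k : ℕ) (g : MvPolynomial σ ℂ) :
    homogeneousComponent (k + N) (g * p) = homogeneousComponent k g * p := by
  conv_lhs => rw [← sum_homogeneousComponent g, Finset.sum_mul, map_sum]
  have h : ∀ i, homogeneousComponent (k + N) (homogeneousComponent i g * p) =
      if k = i then homogeneousComponent i g * p else 0 := by
    intro i
    have hi : (homogeneousComponent i g * p).IsHomogeneous (i + N) :=
      (homogeneousComponent_isHomogeneous i g).mul hp
    rw [homogeneousComponent_of_mem hi]
    simp only [add_left_inj]
  simp only [h, Finset.sum_ite_eq, Finset.mem_range]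
  split_ifs with hk
  · rfl
  · rw [homogeneousComponent_eq_zero k g (by omega), zero_mul]

/-- A multiple of a vector of homogeneous polynomials that is homogeneous of the same degree is a
scalar multiple. -/
theorem exists_scalar_of_isHomogeneous {σ ι : Type*} {N : ℕ} {u w : ι → MvPolynomial σ ℂ}
    (hu : ∀ i, (u i).IsHomogeneous N) (hw : ∀ i, (w i).IsHomogeneous N) {t : MvPolynomial σ ℂ}
    (h : ∀ i, u i = t * w i) : ∃ c : ℂ, u = c • w := by
  -- Equal degrees mean that only the degree zero component of `t` contributes.
  refine ⟨coeff 0 t, funext fun i => ?_⟩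
  have h1 := homogeneousComponent_mul_of_isHomogeneous (hw i) 0 t
  rw [← h, zero_add, homogeneousComponent_eq_self (hu i), homogeneousComponent_zero] at h1
  rw [h1, Pi.smul_apply, smul_eq_C_mul]

/-- The coefficients of a form of degree `D` are weighted homogeneous for the weights given by a
relation among the rays. -/
theorem SimplicialCompleteFan.exists_weight_add_eq {q m : ℕ} (X : SimplicialCompleteFan q m)
    {D : X.ClassGroup} {α : Form1 (Fin m) ℂ}
    (hα : ∀ i s, coeff s (α i) ≠ 0 → X.monomialDegree (s + Finsupp.single i 1) = D)
    {e : Fin m → ℕ} (he : X.IsRelation (fun k => (e k : ℤ))) :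
    ∃ d, ∀ i s, coeff s (α i) ≠ 0 → Finsupp.weight e s + e i = d := by
  classical
  -- A relation pairs to zero with principal divisors, so the weight `e` descends to the class
  -- group.
  have hinv : ∀ s s' : Fin m →₀ ℕ, X.monomialDegree s = X.monomialDegree s' →
      Finsupp.weight e s = Finsupp.weight e s' := by
    intro s s' h
    obtain ⟨u, hu⟩ := (Submodule.Quotient.eq _).1 h
    have hsum : ∑ i, (e i : ℤ) * ((s i : ℤ) - s' i) = 0 := by
      have h1 : ∀ i, (s i : ℤ) - s' i = ∑ j, X.ray i j * u j := fun i => by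
        have := congr_fun hu i
        simpa [Matrix.mulVec, dotProduct] using this.symm
      simp only [h1, Finset.mul_sum]
      rw [Finset.sum_comm]
      refine Finset.sum_eq_zero fun j _ => ?_
      have h2 := congr_fun he j
      simp only [Finset.sum_apply, Pi.smul_apply, smul_eq_mul, Pi.zero_apply] at h2
      calc ∑ i, (e i : ℤ) * (X.ray i j * u j) = (∑ i, (e i : ℤ) * X.ray i j) * u j := by
            rw [Finset.sum_mul]
            exact Finset.sum_congr rfl fun i _ => by ring
        _ = 0 := by rw [h2, zero_mul]
    simp only [mul_sub, Finset.sum_sub_distrib, sub_eq_zero] at hsum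
    have hw : ∀ r : Fin m →₀ ℕ, Finsupp.weight e r = ∑ i, e i * r i := fun r => by
      rw [Finsupp.weight_apply, Finsupp.sum_fintype _ _ (by simp)]
      exact Finset.sum_congr rfl fun i _ => mul_comm _ _
    rw [hw, hw]
    exact_mod_cast hsum
  by_cases hex : ∃ i s, coeff s (α i) ≠ 0
  · obtain ⟨i, s, hs⟩ := hex
    refine ⟨Finsupp.weight e s + e i, fun j s' hs' => ?_⟩
    have h := hinv _ _ ((hα j s' hs').trans (hα i s hs).symm)
    simpa [Finsupp.weight_single] using h
  · push Not at hex
    exact ⟨0, fun i s hs => absurd (hex i s) hs⟩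

variable {m n d : ℕ} {e : Fin m → ℕ} {F G : Fin m → MvPolynomial (Fin (n + 1)) ℂ}
  {α : Form1 (Fin m) ℂ}

/-- This makes the truncated `d - e j` harmless: it is the true difference unless `α j` is zero. -/
theorem le_of_weight_add_eq (hα : ∀ i s, coeff s (α i) ≠ 0 → Finsupp.weight e s + e i = d)
    {j : Fin m} (hj : α j ≠ 0) : e j ≤ d := by
  obtain ⟨s, hs⟩ := ne_zero_iff.1 hj
  have := hα j s hs
  omega

theorem isWeightedHomogeneous_of_weight_add_eq
    (hα : ∀ i s, coeff s (α i) ≠ 0 → Finsupp.weight e s + e i = d) (j : Fin m) :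
    (α j).IsWeightedHomogeneous e (d - e j) := by
  intro s hs
  have := hα j s hs
  omega

theorem isHomogeneous_aeval_coeff
    (hα : ∀ i s, coeff s (α i) ≠ 0 → Finsupp.weight e s + e i = d)
    (hF : ∀ k, (F k).IsHomogeneous (e k)) (j : Fin m) :
    (aeval F (α j)).IsHomogeneous (d - e j) :=
  isHomogeneous_aeval_of_isWeightedHomogeneous hF (isWeightedHomogeneous_of_weight_add_eq hα j)

theorem isHomogeneous_aeval_coeff_mul
    (hα : ∀ i s, coeff s (α i) ≠ 0 → Finsupp.weight e s + e i = d)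
    (hF : ∀ k, (F k).IsHomogeneous (e k)) {j : Fin m} {g : MvPolynomial (Fin (n + 1)) ℂ}
    (hg : g.IsHomogeneous (e j)) : (aeval F (α j) * g).IsHomogeneous d := by
  by_cases hj : α j = 0
  · rw [hj, map_zero, zero_mul]
    exact isHomogeneous_zero _ _ _
  · have h := (isHomogeneous_aeval_coeff hα hF j).mul hg
    rwa [Nat.sub_add_cancel (le_of_weight_add_eq hα hj)] at h

theorem pderiv_eq_zero_of_isHomogeneous_zero {σ : Type*} {g : MvPolynomial σ ℂ}
    (hg : g.IsHomogeneous 0) (l : σ) : pderiv l g = 0 := by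
  rw [totalDegree_eq_zero_iff_eq_C.1 ((totalDegree_zero_iff_isHomogeneous σ).2 hg), pderiv_C]

theorem isHomogeneous_mul_pderiv {σ : Type*} {p g : MvPolynomial σ ℂ} {N k d : ℕ}
    (hp : p.IsHomogeneous N) (hg : g.IsHomogeneous k) (hd : p ≠ 0 → N + k = d) (l : σ) :
    (p * pderiv l g).IsHomogeneous (d - 1) := by
  by_cases h0 : p = 0
  · rw [h0, zero_mul]
    exact isHomogeneous_zero _ _ _
  rcases Nat.eq_zero_or_pos k with rfl | hk
  · rw [pderiv_eq_zero_of_isHomogeneous_zero hg, mul_zero]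
    exact isHomogeneous_zero _ _ _
  · have h := hp.mul (hg.pderiv (i := l))
    have hd' := hd h0
    rwa [show N + (k - 1) = d - 1 by omega] at h

theorem isHomogeneous_aeval_coeff_mul_pderiv
    (hα : ∀ i s, coeff s (α i) ≠ 0 → Finsupp.weight e s + e i = d)
    (hF : ∀ k, (F k).IsHomogeneous (e k)) {j : Fin m} {g : MvPolynomial (Fin (n + 1)) ℂ}
    (hg : g.IsHomogeneous (e j)) (l : Fin (n + 1)) :
    (aeval F (α j) * pderiv l g).IsHomogeneous (d - 1) :=
  isHomogeneous_mul_pderiv (isHomogeneous_aeval_coeff hα hF j) hg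
    (fun h0 => Nat.sub_add_cancel (le_of_weight_add_eq hα fun h => h0 (by rw [h, map_zero]))) l

theorem isHomogeneous_pullback
    (hα : ∀ i s, coeff s (α i) ≠ 0 → Finsupp.weight e s + e i = d)
    (hF : ∀ k, (F k).IsHomogeneous (e k)) (l : Fin (n + 1)) :
    (pullback F α l).IsHomogeneous (d - 1) := by
  rw [pullback_apply]
  exact IsHomogeneous.sum _ _ _ fun j _ => isHomogeneous_aeval_coeff_mul_pderiv hα hF (hF j) l

theorem isHomogeneous_mapDeformation
    (hα : ∀ i s, coeff s (α i) ≠ 0 → Finsupp.weight e s + e i = d)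
    (hF : ∀ k, (F k).IsHomogeneous (e k)) (hG : ∀ k, (G k).IsHomogeneous (e k))
    (l : Fin (n + 1)) : (mapDeformation F G α l).IsHomogeneous (d - 1) := by
  rw [mapDeformation_apply]
  refine IsHomogeneous.sum _ _ _ fun j _ => IsHomogeneous.add ?_
    (isHomogeneous_aeval_coeff_mul_pderiv hα hF (hG j) l)
  rw [Finset.sum_mul]
  refine IsHomogeneous.sum _ _ _ fun k _ => ?_
  have hwt : ∀ s, coeff s (pderiv k (α j)) ≠ 0 → Finsupp.weight e s + e k + e j = d := by
    intro s hs
    rw [coeff_pderiv] at hs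
    have := hα j _ (left_ne_zero_of_mul hs)
    rwa [map_add, Finsupp.weight_single, one_smul] at this
  have hle : pderiv k (α j) ≠ 0 → e k + e j ≤ d := by
    intro h
    obtain ⟨s, hs⟩ := ne_zero_iff.1 h
    have := hwt s hs
    omega
  have h1 : (pderiv k (α j)).IsWeightedHomogeneous e (d - e j - e k) := by
    intro s hs
    have := hwt s hs
    omega
  refine isHomogeneous_mul_pderiv
    ((isHomogeneous_aeval_of_isWeightedHomogeneous hF h1).mul (hG k)) (hF j) (fun h0 => ?_) l
  have := hle fun h => h0 (by rw [h, map_zero, zero_mul])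
  omega

/-- The deformation of `F^*α` in the direction of the Euler vector field. -/
theorem mapDeformation_euler
    (hα : ∀ i s, coeff s (α i) ≠ 0 → Finsupp.weight e s + e i = d) :
    mapDeformation F (fun k => (e k : ℂ) • F k) α = (d : ℂ) • pullback F α := by
  funext l
  rw [mapDeformation_apply, Pi.smul_apply, pullback_apply, Finset.smul_sum]
  refine Finset.sum_congr rfl fun j _ => ?_
  by_cases hj : α j = 0
  · simp [hj]
  have hle := le_of_weight_add_eq hα hj
  -- Weighted Euler identity: it contributes d - e_j, and the term in dG_j supplies the missing e_j.
  have h := congr_arg (aeval F)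
    (isWeightedHomogeneous_of_weight_add_eq hα j).sum_weight_X_mul_pderiv
  have h' : ∑ k, aeval F (pderiv k (α j)) * ((e k : ℂ) • F k) =
      C ((d : ℂ) - e j) * aeval F (α j) := by
    rw [map_nsmul, map_sum] at h
    rw [← Nat.cast_sub hle, ← smul_eq_C_mul, Nat.cast_smul_eq_nsmul, ← h]
    refine Finset.sum_congr rfl fun k _ => ?_
    rw [map_nsmul, map_mul, aeval_X, Nat.cast_smul_eq_nsmul, mul_smul_comm, mul_comm]
  rw [h', Derivation.map_smul, smul_eq_C_mul, smul_eq_C_mul, C_sub]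
  ring

/-- Compare degrees on a nonzero coefficient of ω. For d = 0, every `F j` with `α j` nonzero would
be constant and ω would vanish. -/
theorem eq_of_isProjFoliation {ℓ : ℕ}
    (hα : ∀ i s, coeff s (α i) ≠ 0 → Finsupp.weight e s + e i = d)
    (hF : ∀ k, (F k).IsHomogeneous (e k)) (hω : IsProjFoliation ℓ (pullback F α)) :
    d = ℓ ∧ 0 < ℓ := by
  have hex : ∃ l, pullback F α l ≠ 0 := by
    by_contra! hall
    have hht := hω.2.2
    have : singIdeal (pullback F α) = ⊥ := by
      rw [singIdeal, Ideal.span_eq_bot]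
      rintro _ ⟨l, rfl⟩
      exact hall l
    rw [this, Ideal.height_bot] at hht
    exact absurd hht (by decide)
  obtain ⟨l, hl⟩ := hex
  obtain ⟨s, hs⟩ := ne_zero_iff.1 hl
  have h1 := hω.1.1 l s hs
  have h2 : s.degree = d - 1 := by
    by_contra h
    exact hs ((isHomogeneous_pullback hα hF l).coeff_eq_zero h)
  have h3 : 0 < d := by
    rcases Nat.eq_zero_or_pos d with rfl | h
    · refine absurd ?_ hl
      rw [pullback_apply]
      refine Finset.sum_eq_zero fun j _ => ?_
      by_cases hj : α j = 0
      · rw [hj, map_zero, zero_mul]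
      · have hFj := hF j
        rw [Nat.le_zero.1 (le_of_weight_add_eq hα hj)] at hFj
        rw [pderiv_eq_zero_of_isHomogeneous_zero hFj, mul_zero]
    · exact h
  omega

end Homogeneity

/-! ### Unfoldings of pullbacks -/

section Unfolding

variable {m n ℓ : ℕ} {X : SimplicialCompleteFan 2 m} {D : X.ClassGroup}
  {α : Form1 (Fin m) ℂ} {e : Fin m → ℕ} {F : Fin m → MvPolynomial (Fin (n + 1)) ℂ}

theorem isHomogeneous_of_mem_twistedForms {N : ℕ} {η : Form1 (Fin (n + 1)) ℂ}
    (hη : η ∈ twistedForms n (N + 1)) (i : Fin (n + 1)) : (η i).IsHomogeneous N := by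
  intro s hs
  have := hη.1 i s hs
  have h : Finsupp.degree s = Finsupp.weight 1 s := by
    rw [Finsupp.degree_eq_weight_one]
    rfl
  omega

/-- The unfolding ideal of a generic pullback `F^*α` is generated by the coefficients of `α`
along `F`. -/
theorem mem_span_aeval_of_smul_extD_eq (hα : X.IsFoliation D α)
    (hflat : (aeval F :
      MvPolynomial (Fin m) ℂ →ₐ[ℂ] MvPolynomial (Fin (n + 1)) ℂ).toRingHom.Flat)
    (hgen : IsGenericPair X F α) (hht : 2 ≤ (singIdeal (pullback F α)).height)
    {h : MvPolynomial (Fin (n + 1)) ℂ} {ξ : Form1 (Fin (n + 1)) ℂ}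
    (hξ : h • extD (pullback F α) = wedge (pullback F α) ξ) :
    h ∈ Ideal.span (Set.range fun k => aeval F (α k)) := by
  let : Algebra (MvPolynomial (Fin m) ℂ) (MvPolynomial (Fin (n + 1)) ℂ) :=
    (aeval F : MvPolynomial (Fin m) ℂ →ₐ[ℂ] MvPolynomial (Fin (n + 1)) ℂ).toRingHom.toAlgebra
  have : Module.Flat (MvPolynomial (Fin m) ℂ) (MvPolynomial (Fin (n + 1)) ℂ) := hflat
  refine mem_map_of_forall_mul_mem_of_flat α (fun ij : Fin m × Fin m => extD α ij.1 ij.2)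
    (fun r hr => ?_) (h := h) fun ij => mul_aeval_extD_mem hα.2.1 hht hξ ij.1 ij.2
  refine mem_of_forall_mul_mem_of_isRadical hgen.radical (fun p hp => ?_) hr
  obtain ⟨i, j, hij⟩ := SimplicialCompleteFan.exists_extD_notMem_of_mem_minimalPrimes
    hα.1.2 hgen.radical hgen.codim_deriv hp
  exact ⟨(i, j), hij⟩

/-- A first order unfolding of a generic pullback comes from a deformation of the map. -/
theorem exists_mapDeformation_of_isUnfolding (hα : X.IsFoliation D α)
    (he : X.IsRelation (fun k => (e k : ℤ))) (hF : ∀ k, (F k).IsHomogeneous (e k))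
    (hflat : (aeval F :
      MvPolynomial (Fin m) ℂ →ₐ[ℂ] MvPolynomial (Fin (n + 1)) ℂ).toRingHom.Flat)
    (hgen : IsGenericPair X F α) (hω : IsProjFoliation ℓ (pullback F α))
    {h : MvPolynomial (Fin (n + 1)) ℂ} {η : Form1 (Fin (n + 1)) ℂ}
    (hη : IsUnfolding ℓ (pullback F α) h η) (c : ℂ) :
    ∃ G : Fin m → MvPolynomial (Fin (n + 1)) ℂ, (∀ k, (G k).IsHomogeneous (e k)) ∧
      η + c • pullback F α = mapDeformation F G α := by
  obtain ⟨d, hd⟩ := X.exists_weight_add_eq hα.1.1 he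
  obtain ⟨rfl, hpos⟩ := eq_of_isProjFoliation hd hF hω
  obtain ⟨N, rfl⟩ := Nat.exists_eq_add_one.2 hpos
  obtain ⟨hh, hη1, hη2⟩ := hη
  obtain ⟨g, hg⟩ := Ideal.mem_span_range_iff_exists_fun.1
    (mem_span_aeval_of_smul_extD_eq hα hflat hgen hω.2.2 hη2)
  -- Only these components of `g` contribute to the homogeneous polynomial `h`.
  set G : Fin m → MvPolynomial (Fin (n + 1)) ℂ := fun k => homogeneousComponent (e k) (g k)
  have hG : ∀ k, (G k).IsHomogeneous (e k) := fun k => homogeneousComponent_isHomogeneous _ _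
  have hhG : h = ∑ k, aeval F (α k) * G k := by
    rw [← homogeneousComponent_eq_self hh, ← hg, map_sum]
    refine Finset.sum_congr rfl fun k _ => ?_
    by_cases hk : α k = 0
    · rw [hk, map_zero, mul_zero, zero_mul, map_zero]
    · have h1 := homogeneousComponent_mul_of_isHomogeneous (isHomogeneous_aeval_coeff hd hF k)
        (e k) (g k)
      rw [Nat.add_sub_cancel' (le_of_weight_add_eq hd hk)] at h1
      rw [h1, mul_comm]
  have hunf := smul_extD_pullback_eq_wedge_mapDeformation (F := F) (G := G) hα.2.1
  rw [← hhG] at hunf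
  -- Two unfoldings with the same `h` have forms whose difference wedges to zero with ω.
  obtain ⟨t, ht⟩ := exists_eq_mul_of_two_le_height (w := pullback F α)
    (u := fun l => η l - mapDeformation F G α l) hω.2.2 fun l r => by
      have h1 := congr_fun (congr_fun hη2 l) r
      have h2 := congr_fun (congr_fun hunf l) r
      simp only [Pi.smul_apply, smul_eq_mul, wedge, Pi.sub_apply] at h1 h2
      linear_combination h2 - h1
  obtain ⟨b, hb⟩ := exists_scalar_of_isHomogeneous
    (fun l => (isHomogeneous_of_mem_twistedForms hη1 l).sub
      (isHomogeneous_mapDeformation hd hF hG l))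
    (fun l => isHomogeneous_of_mem_twistedForms hω.1 l) ht
  -- The Euler direction produces (N + 1) ω, so this multiple of it contributes (b + c) ω.
  refine ⟨G + ((b + c) / ((N + 1 : ℕ) : ℂ)) • fun k => (e k : ℂ) • F k, fun k => ?_, ?_⟩
  · have hk : ∀ (x : ℂ) {f : MvPolynomial (Fin (n + 1)) ℂ}, f.IsHomogeneous (e k) →
        (x • f).IsHomogeneous (e k) := fun x f hf => by
      rw [smul_eq_C_mul]; exact hf.C_mul x
    exact (hG k).add (hk _ (hk _ (hF k)))
  · rw [mapDeformation_add, mapDeformation_smul, mapDeformation_euler hd, smul_smul,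
      div_mul_cancel₀ _ (Nat.cast_ne_zero.2 (Nat.succ_ne_zero N)), add_smul, ← hb]
    funext l
    simp only [Pi.add_apply]
    ring

end Unfolding

end ToricFoliation

/-! ### The characterization of deformations coming from unfoldings -/

theorem theorem6p18 {m n ℓ : ℕ} (X : SimplicialCompleteFan 2 m) (D : X.ClassGroup)
    (α : Form1 (Fin m) ℂ) (hα : X.IsFoliation D α)
    (e : Fin m → ℕ) (he : X.IsRelation (fun k => (e k : ℤ)))
    (F : Fin m → MvPolynomial (Fin (n + 1)) ℂ) (hF : ∀ k, (F k).IsHomogeneous (e k))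
    (hflat : (MvPolynomial.aeval F :
      MvPolynomial (Fin m) ℂ →ₐ[ℂ] MvPolynomial (Fin (n + 1)) ℂ).toRingHom.Flat)
    (hgen : IsGenericPair X F α)
    (hω : IsProjFoliation ℓ (pullback F α))
    (η : deformationForms ℓ (pullback F α)) :
    ((Submodule.Quotient.mk η : Deformations ℓ (pullback F α)) ∈
        unfoldingDeformations ℓ (pullback F α) ↔
      ∃ G : Fin m → MvPolynomial (Fin (n + 1)) ℂ,
        (∀ k, (G k).IsHomogeneous (e k)) ∧
        (η : Form1 (Fin (n + 1)) ℂ) = mapDeformation F G α) ∧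
    ∀ G : Fin m → MvPolynomial (Fin (n + 1)) ℂ,
      (∀ k, (G k).IsHomogeneous (e k)) →
      (η : Form1 (Fin (n + 1)) ℂ) = mapDeformation F G α →
      addEps (pullback F α) (η : Form1 (Fin (n + 1)) ℂ) =
        pullback (addEps F G) (fun j => toDual (α j)) := by
  refine ⟨⟨?_, ?_⟩, ?_⟩
  · rintro ⟨h, η', hη', heq⟩
    rw [Submodule.Quotient.eq] at heq
    -- The class fixes the form only up to ω: here η' - η = c ω, hence the shift by -c below.
    obtain ⟨c, hc⟩ := Submodule.mem_span_singleton.1 (Submodule.mem_comap.1 heq)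
    obtain ⟨G, hG, hGη⟩ :=
      exists_mapDeformation_of_isUnfolding hα he hF hflat hgen hω hη' (-c)
    refine ⟨G, hG, ?_⟩
    rw [← hGη, neg_smul, hc]
    simp
  · rintro ⟨G, hG, hGη⟩
    obtain ⟨d, hd⟩ := X.exists_weight_add_eq hα.1.1 he
    obtain ⟨rfl, -⟩ := eq_of_isProjFoliation hd hF hω
    -- The unfolding function is the contraction of α with G along `F`.
    refine ⟨∑ k, MvPolynomial.aeval F (α k) * G k, η,
      ⟨MvPolynomial.IsHomogeneous.sum _ _ _ fun k _ =>
        isHomogeneous_aeval_coeff_mul hd hF (hG k), η.2.1, ?_⟩, rfl⟩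
    rw [hGη]
    exact smul_extD_pullback_eq_wedge_mapDeformation hα.2.1
  · intro G _ hGη
    rw [hGη]
    exact addEps_pullback_mapDeformation
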